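/- Let $D\ge 1$, $a,b>0$, $\alpha>0$ and $\sigma_{\mathbf y}^2>0$ be fixed. For every $N\ge 0$ consider the following Bayesian model for $D$-dimensional observations $\mathbf y_1,\dots,\mathbf y_N$ with fixed noise variance $\sigma^2>0$: $$\mathbf y_n=\mathbf P(\mathbf z_n\odot \mathbf x_n)+\mathbf e_n,\qquad \mathbf e_n\overset{iid}{\sim}\mathcal N(0,\sigma^2 I_D),$$ where $\odot$ is the entrywise product and, a priori and independently of the noise: (i) $\mathbf P$ is uniformly (Haar) distributed on the orthogonal group $\mathcal O_D$; (ii) the scale parameters $\delta_1^2,\dots,\delta_D^2$ are i.i.d. with the shifted inverse gamma density $\frac{b^a}{\gamma(a,b)}(1+x)^{-(a+1)}e^{-b/(1+x)}$ on $x>0$, where $\gamma(a,b)=\int_0^b t^{a-1}e^{-t}\,dt$; (iii) given $(\delta_k^2)_k$, the coefficients $x_{k,n}$ are independent with $x_{k,n}\sim\mathcal N(0,\delta_k^2\sigma^2)$; (iv) the binary activation matrix $\mathbf Z=[\mathbf z_1,\dots,\mathbf z_N]$ (considered up to permutation of its rows), independent of the previous quantities, has the Indian buffet process prior of parameter $\alpha$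 restricted to matrices with at most $D$ nonzero rows, i.e. a prior probability proportional to $$\mathrm P[\mathbf Z\mid\alpha]=\frac{\alpha^{K}e^{-\alpha\sum_{n=1}^N 1/n}}{\prod_{h\ne 0}K_h!}\prod_{k=1}^{K}\frac{(N-m_k)!\,(m_k-1)!}{N!},$$ where $K$ is the number of nonzero rows, $m_k$ the number of ones in the $k$-th nonzero row, and $K_h$ the number of rows equal to $h\in\{0,1\}^N$. Let $K_N\in\{0,\dots,D\}$ be the number of nonzero rows of $\mathbf Z$ (the dimension of the latent subspace), and, for $\mathbf Y_N=[\mathbf y_1,\dots,\mathbf y_N]$, let $$\mathrm P\big(K_N=k\mid \mathbf Y_N,\alpha,\sigma^2\big)=\frac{\sum_{\mathbf Z:\,K=k}\mathrm P[\mathbf Z\mid\alpha]\,\mathrm p(\mathbf Y_N\mid\mathbf Z,\sigma^2)}{\sum_{\mathbf Z:\,K\le D}\mathrm P[\mathbf Z\mid\alpha]\,\mathrm p(\mathbf Y_N\mid\mathbf Z,\sigma^2)}$$ be its posterior probability given by the Bayes rule, where $\mathrm p(\mathbf Y_N\mid\mathbf Z,\sigma^2)$ is the Gaussian likelihood integrated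 over the priors of $\mathbf X,\mathbf P,(\delta_k^2)_k$. Suppose that the observations $\mathbf y_1,\mathbf y_2,\dots$ are actually independent and identically distributed according to the centered isotropic Gaussian distribution $\mathcal N(0,\sigma_{\mathbf y}^2 I_D)$. Then the posterior probability computed with $\sigma^2=\sigma_{\mathbf y}^2$ satisfies $$\mathrm P\big(K_N=0\mid\mathbf Y_N,\alpha,\sigma_{\mathbf y}^2\big)\longrightarrow 0\quad\text{almost surely as }N\to\infty .$$ -/

import Mathlib

open MeasureTheory ProbabilityTheory Filter Topology
open scoped ENNReal

namespace BNPPCA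

/-! ### The uniform distribution on the orthogonal group -/

/-- The orthogonal group carries its Borel sigma-algebra. -/
instance instMeasurableSpaceOrthogonal (D : ℕ) :
    MeasurableSpace (Matrix.orthogonalGroup (Fin D) ℝ) := borel _

instance instBorelSpaceOrthogonal (D : ℕ) :
    BorelSpace (Matrix.orthogonalGroup (Fin D) ℝ) := ⟨rfl⟩

instance instCompactSpaceOrthogonal (D : ℕ) :
    CompactSpace (Matrix.orthogonalGroup (Fin D) ℝ) := by
  have hclosed : IsClosed
      ((Matrix.orthogonalGroup (Fin D) ℝ : Set (Matrix (Fin D) (Fin D) ℝ))) := by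
    have h : (Matrix.orthogonalGroup (Fin D) ℝ : Set (Matrix (Fin D) (Fin D) ℝ)) =
        {A | star A * A = 1} := by
      ext A
      exact Matrix.mem_unitaryGroup_iff'
    rw [h]
    exact isClosed_eq (by fun_prop) continuous_const
  have hbox : IsCompact (Set.pi Set.univ fun _ : Fin D =>
      Set.pi Set.univ fun _ : Fin D => Set.Icc (-1 : ℝ) 1) :=
    isCompact_univ_pi fun _ => isCompact_univ_pi fun _ => isCompact_Icc
  refine isCompact_iff_compactSpace.mp (hbox.of_isClosed_subset hclosed ?_)
  intro A hA i _ j _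
  have h := entry_norm_bound_of_unitary (𝕜 := ℝ) hA i j
  rw [Real.norm_eq_abs] at h
  exact abs_le.mp h

/-- The uniform distribution on the orthogonal group of `ℝ^D`: the Haar measure of total
mass one. -/
noncomputable def uniformOrthogonal (D : ℕ) : Measure (Matrix.orthogonalGroup (Fin D) ℝ) :=
  Measure.haarMeasure ⊤

/-! ### The shifted inverse gamma distribution -/

/-- The lower incomplete gamma function `γ(a, b) = ∫_0^b t^(a-1) e^(-t) dt`. -/
noncomputable def lowerGamma (a b : ℝ) : ℝ :=
  ∫ t in (0 : ℝ)..b, t ^ (a - 1) * Real.exp (-t)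

/-- The density of the shifted inverse gamma distribution with shape `a` and rate `b`. -/
noncomputable def sIGDensity (a b x : ℝ) : ℝ :=
  if 0 < x then
    b ^ a / lowerGamma a b * (1 / (1 + x)) ^ (a + 1) * Real.exp (-b / (1 + x))
  else 0

/-- The shifted inverse gamma distribution with shape `a` and rate `b`. -/
noncomputable def sIG (a b : ℝ) : Measure ℝ :=
  volume.withDensity fun x => ENNReal.ofReal (sIGDensity a b x)

/-! ### The Indian buffet process

A feature allocation of `N` observations with at most `D` features is encoded by a binary
`D × N` matrix in left-ordered form: the rows, read as binary numbers whose most significant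
digit is the first one, are in decreasing order, so that the zero rows (inactive features)
come last. Each equivalence class of binary matrices modulo permutation of the rows has exactly
one such representative. -/

/-- The row of `Z` number `k` is active: feature `k` is used by at least one observation. -/
def IsActive {D N : ℕ} (Z : Fin D → Fin N → Bool) (k : Fin D) : Prop :=
  ∃ n, Z k n = true

open Classical in
/-- The number `m_k` of observations that use feature `k`. -/
noncomputable def rowCount {D N : ℕ} (Z : Fin D → Fin N → Bool) (k : Fin D) : ℕ :=
  (Finset.univ.filter fun n => Z k n = true).card

open Classical in
/-- The number `K` of active features, i.e. the dimension of the latent subspace. -/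
noncomputable def numActive {D N : ℕ} (Z : Fin D → Fin N → Bool) : ℕ :=
  (Finset.univ.filter fun k => IsActive Z k).card

open Classical in
/-- The number `K_h` of rows of `Z` that are equal to the history `h`. -/
noncomputable def historyCount {D N : ℕ} (Z : Fin D → Fin N → Bool) (h : Fin N → Bool) : ℕ :=
  (Finset.univ.filter fun k => Z k = h).card

open Classical in
/-- The set of binary `D × N` matrices in left-ordered form. -/
noncomputable def leftOrdered (D N : ℕ) : Finset (Fin D → Fin N → Bool) :=
  Finset.univ.filter fun Z => Antitone fun k => toLex (Z k)

open Classical in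
/-- The probability `P[Z | α]` given by the Indian buffet process of parameter `α` to (the class
of) the matrix `Z`; the product of the `K_h !` is over the `2^N - 1` nonzero histories. -/
noncomputable def ibpProb {D N : ℕ} (α : ℝ) (Z : Fin D → Fin N → Bool) : ℝ :=
  α ^ numActive Z * Real.exp (-α * ∑ n ∈ Finset.Icc 1 N, (1 / n : ℝ))
    / (∏ h ∈ Finset.univ.filter (fun h : Fin N → Bool => ∃ n, h n = true),
        ((historyCount Z h).factorial : ℝ))
    * ∏ k ∈ Finset.univ.filter (fun k => IsActive Z k),
        (((N - rowCount Z k).factorial : ℝ) * ((rowCount Z k - 1).factorial : ℝ)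
          / (N.factorial : ℝ))

/-! ### The latent factor model `y_n = P (z_n ⊙ x_n) + e_n` -/

/-- The noiseless observation `P (z_n ⊙ x_n)`. -/
noncomputable def signal {D N : ℕ} (P : Matrix (Fin D) (Fin D) ℝ) (Z : Fin D → Fin N → Bool)
    (X : Fin D → Fin N → ℝ) (n : Fin N) : EuclideanSpace ℝ (Fin D) :=
  WithLp.toLp 2 (P.mulVec fun k => if Z k n then X k n else 0)

/-- The likelihood `f(Y | P, Z, X, σ²)`. The variance `σ²` is denoted `σ2`. -/
noncomputable def likelihood {D N : ℕ} (σ2 : ℝ) (Y : Fin N → EuclideanSpace ℝ (Fin D))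
    (P : Matrix (Fin D) (Fin D) ℝ) (Z : Fin D → Fin N → Bool) (X : Fin D → Fin N → ℝ) : ℝ :=
  (2 * Real.pi * σ2) ^ (-((D : ℝ) * (N : ℝ) / 2))
    * Real.exp (-(1 / (2 * σ2)) * ∑ n, ‖Y n - signal P Z X n‖ ^ 2)

/-- The prior of the coefficients given the scale parameters `δ_k²` (here `δ k`) and `σ²`: they
are independent, the one with index `(k, n)` having law `N(0, δ_k² σ²)`. -/
noncomputable def coeffPrior (D N : ℕ) (σ2 : ℝ) (δ : Fin D → ℝ) : Measure (Fin D → Fin N → ℝ) :=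
  Measure.pi fun k => Measure.pi fun _ => gaussianReal 0 (δ k * σ2).toNNReal

/-- The marginal likelihood `p(Y | Z, σ²)`: the likelihood integrated with respect to the priors
of the coefficients, of the orthonormal basis and of the scale parameters. -/
noncomputable def marginalLikelihood {D N : ℕ} (a b σ2 : ℝ)
    (Y : Fin N → EuclideanSpace ℝ (Fin D)) (Z : Fin D → Fin N → Bool) : ℝ≥0∞ :=
  ∫⁻ δ, ∫⁻ P, ∫⁻ X, ENNReal.ofReal (likelihood σ2 Y (P : Matrix (Fin D) (Fin D) ℝ) Z X)
    ∂(coeffPrior D N σ2 δ) ∂(uniformOrthogonal D) ∂(Measure.pi fun _ : Fin D => sIG a b)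

open Classical in
/-- The joint weight `p(K_N = k, Y | α, σ²)`, that is, the sum of `P[Z | α] p(Y | Z, σ²)` over all
feature allocations `Z` with exactly `k` active features. -/
noncomputable def jointWeight {D N : ℕ} (a b α σ2 : ℝ)
    (Y : Fin N → EuclideanSpace ℝ (Fin D)) (k : ℕ) : ℝ≥0∞ :=
  ∑ Z ∈ (leftOrdered D N).filter (fun Z => numActive Z = k),
    ENNReal.ofReal (ibpProb α Z) * marginalLikelihood a b σ2 Y Z

/-- The posterior probability `P(K_N = k | Y, α, σ²)` given by the Bayes rule. As the basis is
orthonormal in `ℝ^D`, allocations with more than `D` active features are excluded. -/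
noncomputable def posteriorDim {D N : ℕ} (a b α σ2 : ℝ)
    (Y : Fin N → EuclideanSpace ℝ (Fin D)) (k : ℕ) : ℝ≥0∞ :=
  jointWeight a b α σ2 Y k / ∑ j ∈ Finset.range (D + 1), jointWeight a b α σ2 Y j

end BNPPCA

namespace BNPPCA

/-! ### Elementary symmetric sums -/

/-! Pure noise cannot rule out a single feature used by only a few observations, and the prior gives
such allocations too much total weight. With `σ2` equal to the true variance, divide the likelihood
of a single feature used exactly on `S` by the noise likelihood. Given the scales and basis `θ`,
this ratio is a product over `S` of i.i.d. nonnegative variables of mean one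
(`lintegral_basisRatio`). The Indian buffet weight of such an allocation, relative to the empty one,
is `α / m` divided by `N.choose m`, where `m` is the size of `S`. So the allocations of size `m`
together weigh `α / m` times an average over `m`-subsets, namely a normalised elementary symmetric
polynomial integrated over `θ` (`sum_powersetCard_weight`). For fixed `θ` and `m`, the strong law
makes the lower limit of this polynomial at least one (`one_le_liminf_esymm`). Fubini and Fatou
carry the bound to the integral over `θ` (`ae_measure_univ_le_liminf`). Hence, for each fixed `M`
and all large `N`, the weight of `K = 1` is at least `α / 2 * ∑ m ≤ M, 1 / m` times that of `K = 0`.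
The harmonic series diverges, so the posterior probability of `K = 0` tends to zero. -/

lemma sum_powersetCard_succ_insert {ι R : Type*} [DecidableEq ι] [CommSemiring R] {a : ι}
    {s : Finset ι} (ha : a ∉ s) (m : ℕ) (f : ι → R) :
    ∑ S ∈ (insert a s).powersetCard (m + 1), ∏ i ∈ S, f i =
      ∑ S ∈ s.powersetCard (m + 1), ∏ i ∈ S, f i
        + f a * ∑ S ∈ s.powersetCard m, ∏ i ∈ S, f i := by
  rw [Finset.powersetCard_succ_insert ha, Finset.sum_union, Finset.sum_image, Finset.mul_sum]
  · congr 1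
    refine Finset.sum_congr rfl fun S hS => ?_
    rw [Finset.prod_insert fun h => ha ((Finset.mem_powersetCard.1 hS).1 h)]
  · intro S hS T hT h
    have hS' : a ∉ S := fun h => ha ((Finset.mem_powersetCard.1 hS).1 h)
    have hT' : a ∉ T := fun h => ha ((Finset.mem_powersetCard.1 hT).1 h)
    rw [← Finset.erase_insert hS', ← Finset.erase_insert hT']
    exact congrArg (fun U => U.erase a) h
  · rw [Finset.disjoint_left]
    intro S hS hS'
    obtain ⟨T, -, rfl⟩ := Finset.mem_image.1 hS'
    exact ha ((Finset.mem_powersetCard.1 hS).1 (Finset.mem_insert_self a T))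

/-- Expanding the product of the first and `m`-th elementary symmetric sums, a new index yields each
`(m + 1)`-set `m + 1` times. A repeated index yields each `m`-set `m` times, with an extra factor at
most `B`. -/
lemma sum_mul_sum_powersetCard_le {ι : Type*} [DecidableEq ι] (s : Finset ι) (f : ι → ℝ) (B : ℝ)
    (h0 : ∀ i, 0 ≤ f i) (hB : ∀ i ∈ s, f i ≤ B) (m : ℕ) :
    (∑ i ∈ s, f i) * ∑ S ∈ s.powersetCard m, ∏ i ∈ S, f i ≤
      (m + 1) * ∑ S ∈ s.powersetCard (m + 1), ∏ i ∈ S, f i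
        + m * B * ∑ S ∈ s.powersetCard m, ∏ i ∈ S, f i := by
  have hone : ∀ t : Finset ι, ∑ S ∈ t.powersetCard 1, ∏ i ∈ S, f i = ∑ i ∈ t, f i := by
    intro t
    simp [Finset.powersetCard_one]
  induction s using Finset.induction_on generalizing m with
  | empty =>
    rcases m with _ | m
    · simpa using Finset.sum_nonneg fun S _ => Finset.prod_nonneg fun i _ => h0 i
    · have h : ∀ j : ℕ, (∅ : Finset ι).powersetCard (j + 1) = ∅ := fun j =>
        Finset.powersetCard_eq_empty.2 (by simp)
      simp [h]
  | insert a s ha ih =>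
    have ihs := ih fun i hi => hB i (Finset.mem_insert_of_mem hi)
    have hBa := hB a (Finset.mem_insert_self a s)
    rcases m with _ | m
    · simp [hone]
    · rw [Finset.sum_insert ha, sum_powersetCard_succ_insert ha, sum_powersetCard_succ_insert ha]
      -- The subsets containing `a` use the bound at `m` multiplied by `f a`, the others the bound
      -- at `m + 1`; the leftover term with `f a` squared costs one more `B`.
      have h1 := ihs m
      have h2 := ihs (m + 1)
      have hnn : 0 ≤ ∑ S ∈ s.powersetCard m, ∏ i ∈ S, f i :=
        Finset.sum_nonneg fun S _ => Finset.prod_nonneg fun i _ => h0 i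
      have h3 := mul_le_mul_of_nonneg_left h1 (h0 a)
      have h4 : f a * (f a * ∑ S ∈ s.powersetCard m, ∏ i ∈ S, f i) ≤
          f a * (B * ∑ S ∈ s.powersetCard m, ∏ i ∈ S, f i) :=
        mul_le_mul_of_nonneg_left (mul_le_mul_of_nonneg_right hBa hnn) (h0 a)
      push_cast at h2 ⊢
      linarith

/-- Early terms contribute a constant, negligible against `N`; a late term `x i` is at most `ε / 2 *
i ≤ ε / 2 * N`. -/
lemma tendsto_partialSups_div {x : ℕ → ℝ} (h0 : ∀ i, 0 ≤ x i)
    (hx : Tendsto (fun N : ℕ => x N / N) atTop (𝓝 0)) :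
    Tendsto (fun N : ℕ => partialSups x N / N) atTop (𝓝 0) := by
  have hnn : ∀ N, 0 ≤ partialSups x N := fun N => (h0 N).trans (le_partialSups x N)
  rw [Metric.tendsto_atTop]
  intro ε hε
  obtain ⟨N₀, hN₀⟩ := Metric.tendsto_atTop.1 hx (ε / 2) (half_pos hε)
  obtain ⟨N₁, hN₁⟩ := exists_nat_gt (partialSups x N₀ / (ε / 2))
  refine ⟨max N₁ 1, fun N hN => ?_⟩
  have hN1 : (0 : ℝ) < N := by
    exact_mod_cast lt_of_lt_of_le one_pos ((le_max_right _ _).trans hN)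
  have hNN₁ : (N₁ : ℝ) ≤ N := by exact_mod_cast (le_max_left _ _).trans hN
  rw [Real.dist_eq, sub_zero, abs_of_nonneg (div_nonneg (hnn N) hN1.le), div_lt_iff₀ hN1]
  have hle : partialSups x N ≤ partialSups x N₀ + ε / 2 * N := by
    refine partialSups_le _ _ _ fun i hi => ?_
    have hiN : (i : ℝ) ≤ N := by exact_mod_cast hi
    rcases le_total i N₀ with h | h
    · exact (le_partialSups_of_le x h).trans (le_add_of_nonneg_right (by positivity))
    · have := hN₀ i h
      -- At `i = 0` the quotient is `0` by convention and says nothing about `x 0`.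
      rcases Nat.eq_zero_or_pos i with rfl | hi0
      · exact (le_partialSups_of_le x (Nat.zero_le _)).trans
          (le_add_of_nonneg_right (by positivity))
      · have hi0' : (0 : ℝ) < i := by exact_mod_cast hi0
        rw [Real.dist_eq, sub_zero, abs_of_nonneg (div_nonneg (h0 i) hi0'.le),
          div_lt_iff₀ hi0'] at this
        have h3 : ε / 2 * (i : ℝ) ≤ ε / 2 * N := by gcongr
        linarith [hnn N₀]
  have : partialSups x N₀ < ε / 2 * N := by
    rw [div_lt_iff₀ (half_pos hε)] at hN₁
    nlinarith
  linarith

/-- The term `x N` is a difference of consecutive partial sums, whose averages have the same limit.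
-/
lemma tendsto_div_of_tendsto_average {x : ℕ → ℝ} {c : ℝ}
    (hx : Tendsto (fun N : ℕ => (∑ i ∈ Finset.range N, x i) / N) atTop (𝓝 c)) :
    Tendsto (fun N : ℕ => x N / N) atTop (𝓝 0) := by
  have h1 := (tendsto_add_atTop_iff_nat 1).2 hx
  have h2 : Tendsto (fun N : ℕ => ((N + 1 : ℕ) : ℝ) / N) atTop (𝓝 1) := by
    have h3 : Tendsto (fun N : ℕ => 1 + 1 / (N : ℝ)) atTop (𝓝 (1 + 0)) :=
      tendsto_const_nhds.add tendsto_one_div_atTop_nhds_zero_nat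
    rw [add_zero] at h3
    refine h3.congr' ?_
    filter_upwards [eventually_gt_atTop 0] with N hN
    have : (N : ℝ) ≠ 0 := by positivity
    push_cast
    field_simp
  have h4 := (h1.mul h2).sub hx
  rw [mul_one, sub_self] at h4
  refine h4.congr' ?_
  filter_upwards [eventually_gt_atTop 0] with N hN
  have : (N : ℝ) ≠ 0 := by positivity
  have h5 : ((N + 1 : ℕ) : ℝ) ≠ 0 := by positivity
  rw [Finset.sum_range_succ]
  field_simp
  ring

/-- The elementary symmetric means of a nonnegative sequence whose averages converge to one are
asymptotically at least one. -/
lemma exists_tendsto_one_le_esymm {x : ℕ → ℝ} (h0 : ∀ i, 0 ≤ x i)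
    (hx : Tendsto (fun N : ℕ => (∑ i ∈ Finset.range N, x i) / N) atTop (𝓝 1)) (m : ℕ) :
    ∃ l : ℕ → ℝ, Tendsto l atTop (𝓝 1) ∧ ∀ᶠ N in atTop, l N * (N : ℝ) ^ m ≤
      m.factorial * ∑ S ∈ (Finset.univ : Finset (Fin N)).powersetCard m, ∏ i ∈ S, x i := by
  induction m with
  | zero => exact ⟨fun _ => 1, tendsto_const_nhds, by simp⟩
  | succ m ih =>
    obtain ⟨l, hl, hle⟩ := ih
    have hB := tendsto_partialSups_div h0 (tendsto_div_of_tendsto_average hx)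
    have hq := hx.sub (hB.const_mul (m : ℝ))
    rw [mul_zero, sub_zero] at hq
    -- The new factor is the average minus `m` times the running maximum over `N`, the latter being
    -- the cost of repeated indices. It tends to one because the maximum is `o(N)`.
    refine ⟨_, by simpa using hl.mul hq, ?_⟩
    filter_upwards [hle, hq.eventually_const_le one_pos, eventually_gt_atTop 0] with N hN hqN hN0
    have hN' : (N : ℝ) ≠ 0 := by positivity
    have key := sum_mul_sum_powersetCard_le (Finset.univ : Finset (Fin N)) (fun i => x i)
      (partialSups x N) (fun i => h0 i) (fun i _ => le_partialSups_of_le x i.2.le) m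
    rw [Fin.sum_univ_eq_sum_range] at key
    have hfac : (0 : ℝ) ≤ m.factorial := by positivity
    have h1 := mul_le_mul_of_nonneg_left key hfac
    have h2 := mul_le_mul_of_nonneg_right hN
      (mul_nonneg hqN (Nat.cast_nonneg (α := ℝ) N))
    have h3 : ((∑ i ∈ Finset.range N, x i) / N - m * (partialSups x N / N)) * N
        = ∑ i ∈ Finset.range N, x i - m * partialSups x N := by
      field_simp
    rw [h3] at h2
    rw [Nat.factorial_succ]
    push_cast
    have h4 : l N * ((∑ i ∈ Finset.range N, x i) / N - m * (partialSups x N / N)) * (N : ℝ) ^ (m + 1)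
        = l N * (N : ℝ) ^ m * (∑ i ∈ Finset.range N, x i - m * partialSups x N) := by
      rw [← h3]; ring
    rw [h4]
    linarith

lemma one_le_liminf_esymm {F : ℕ → ℝ≥0∞} (hF : ∀ i, F i ≠ ∞)
    (hx : Tendsto (fun N : ℕ => (∑ i ∈ Finset.range N, (F i).toReal) / N) atTop (𝓝 1)) (m : ℕ) :
    1 ≤ liminf (fun N : ℕ => (∑ S ∈ (Finset.univ : Finset (Fin N)).powersetCard m,
      ∏ i ∈ S, F i) / (N.choose m : ℝ≥0∞)) atTop := by
  obtain ⟨l, hl, hle⟩ := exists_tendsto_one_le_esymm (fun i => ENNReal.toReal_nonneg) hx m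
  have h1 : Tendsto (fun N => ENNReal.ofReal (l N)) atTop (𝓝 1) := by
    simpa using ENNReal.tendsto_ofReal hl
  rw [← h1.liminf_eq]
  refine liminf_le_liminf ?_
  filter_upwards [hle, hl.eventually_const_le one_pos, eventually_ge_atTop m] with N hN hl0 hmN
  have hc : (0 : ℝ) < N.choose m := by exact_mod_cast Nat.choose_pos hmN
  rw [ENNReal.le_div_iff_mul_le (Or.inl (by exact_mod_cast hc.ne')) (Or.inl (by simp))]
  have h2 : (∑ S ∈ (Finset.univ : Finset (Fin N)).powersetCard m, ∏ i ∈ S, F i) =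
      ENNReal.ofReal (∑ S ∈ (Finset.univ : Finset (Fin N)).powersetCard m,
        ∏ i ∈ S, (F i).toReal) := by
    rw [ENNReal.ofReal_sum_of_nonneg
      fun S _ => Finset.prod_nonneg fun i _ => ENNReal.toReal_nonneg]
    refine Finset.sum_congr rfl fun S _ => ?_
    rw [ENNReal.ofReal_prod_of_nonneg fun i _ => ENNReal.toReal_nonneg]
    exact Finset.prod_congr rfl fun i _ => (ENNReal.ofReal_toReal (hF i)).symm
  rw [h2, ← ENNReal.ofReal_natCast, ← ENNReal.ofReal_mul hl0]
  refine ENNReal.ofReal_le_ofReal ?_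
  have hfac : (0 : ℝ) < m.factorial := by positivity
  -- Replacing `N ^ m` by the smaller `m! * N.choose m` only weakens the lower bound.
  have h3 : (m.factorial : ℝ) * N.choose m ≤ (N : ℝ) ^ m := by
    exact_mod_cast (Nat.descFactorial_eq_factorial_mul_choose N m ▸ Nat.descFactorial_le_pow N m)
  have h4 := mul_le_mul_of_nonneg_left h3 hl0
  refine le_of_mul_le_mul_left ?_ hfac
  linarith

/-! ### The likelihood ratio of an active feature -/

/-- The likelihood ratio of an observation whose coordinate along an active direction is `t`, for a
coefficient of prior law `N(0, v)`. -/
noncomputable def featureRatio (σ2 : ℝ) (v : NNReal) (t : ℝ) : ℝ≥0∞ :=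
  ∫⁻ x, ENNReal.ofReal (Real.exp (x * t / σ2 - x ^ 2 / (2 * σ2))) ∂gaussianReal 0 v

/-- Writing `N(0, v)` as the image of `N(0, 1)` under scaling by `√v` moves the parameter from the
measure into the integrand. For a negative product `q.1 * σ2`, both `√` and `toNNReal` vanish, so
the identity still holds. -/
lemma measurable_featureRatio (σ2 : ℝ) :
    Measurable fun q : ℝ × ℝ => featureRatio σ2 (q.1 * σ2).toNNReal q.2 := by
  have h : ∀ q : ℝ × ℝ, featureRatio σ2 (q.1 * σ2).toNNReal q.2 =
      ∫⁻ x, ENNReal.ofReal (Real.exp (√(q.1 * σ2) * x * q.2 / σ2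
        - (√(q.1 * σ2) * x) ^ 2 / (2 * σ2))) ∂gaussianReal 0 1 := by
    intro q
    have hv : (gaussianReal 0 1).map (fun x => √(q.1 * σ2) * x) =
        gaussianReal 0 (q.1 * σ2).toNNReal := by
      rw [gaussianReal_map_const_mul, mul_zero]
      congr 1
      ext
      simp [Real.sq_sqrt']
    rw [featureRatio, ← hv, lintegral_map (by fun_prop) (by fun_prop)]
  simp_rw [h]
  exact Measurable.lintegral_prod_right (by fun_prop)

/-- By Tonelli, integrate over `t` first: for each `x` the integrand is the density of `N(x, σ2)`
with respect to `N(0, σ2)`. -/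
lemma lintegral_featureRatio {σ2 : ℝ} (hσ2 : 0 < σ2) (v : NNReal) :
    ∫⁻ t, featureRatio σ2 v t ∂gaussianReal 0 σ2.toNNReal = 1 := by
  unfold featureRatio
  rw [lintegral_lintegral_swap (by fun_prop)]
  have h : ∀ x : ℝ, ∫⁻ t, ENNReal.ofReal (Real.exp (x * t / σ2 - x ^ 2 / (2 * σ2)))
      ∂gaussianReal 0 σ2.toNNReal = 1 := by
    intro x
    have h1 : ∀ t : ℝ, ENNReal.ofReal (Real.exp (x * t / σ2 - x ^ 2 / (2 * σ2))) =
        ENNReal.ofReal (Real.exp (-(x ^ 2 / (2 * σ2)))) *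
          ENNReal.ofReal (Real.exp (x / σ2 * t)) := by
      intro t
      rw [← ENNReal.ofReal_mul (Real.exp_pos _).le, ← Real.exp_add]
      congr 2
      ring
    simp_rw [h1]
    rw [lintegral_const_mul _ (by fun_prop), ← ofReal_integral_eq_lintegral_ofReal
      (integrable_exp_mul_gaussianReal _) (ae_of_all _ fun t => (Real.exp_pos _).le)]
    have h2 := congrFun (mgf_fun_id_gaussianReal (μ := 0) (v := σ2.toNNReal)) (x / σ2)
    rw [mgf] at h2
    rw [h2, ← ENNReal.ofReal_mul (Real.exp_pos _).le, ← Real.exp_add,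
      Real.coe_toNNReal _ hσ2.le]
    have h3 : -(x ^ 2 / (2 * σ2)) + (0 * (x / σ2) + σ2 * (x / σ2) ^ 2 / 2) = 0 := by
      field_simp
      ring
    rw [h3]
    simp
  simp [h]

lemma sum_sq_col_orthogonalGroup {D : ℕ} (P : Matrix.orthogonalGroup (Fin D) ℝ) (k : Fin D) :
    ∑ i, (P : Matrix (Fin D) (Fin D) ℝ) i k ^ 2 = 1 := by
  have h := Matrix.mem_unitaryGroup_iff'.1 P.2
  have h' := congrFun (congrFun h k) k
  rw [Matrix.mul_apply] at h'
  simpa [Matrix.star_apply, sq] using h'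

/-- Isotropy: whatever the basis, the coordinate along a unit column has the noise law, so the
mean-one property holds for every `θ`. -/
lemma hasLaw_dotProduct {Ω : Type*} [MeasurableSpace Ω] {μ : Measure Ω} {D : ℕ} {σ2 : ℝ}
    (hσ2 : 0 < σ2) {Y : Ω → EuclideanSpace ℝ (Fin D)}
    (hY : HasLaw Y (multivariateGaussian 0 (σ2 • (1 : Matrix (Fin D) (Fin D) ℝ))) μ)
    {u : Fin D → ℝ} (hu : ∑ i, u i ^ 2 = 1) :
    HasLaw (fun ω => ∑ i, u i * Y ω i) (gaussianReal 0 σ2.toNNReal) μ := by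
  have hS : (σ2 • (1 : Matrix (Fin D) (Fin D) ℝ)).PosSemidef :=
    Matrix.PosSemidef.one.smul hσ2.le
  let L : StrongDual ℝ (EuclideanSpace ℝ (Fin D)) := innerSL ℝ (WithLp.toLp 2 u)
  have hL : ∀ y : EuclideanSpace ℝ (Fin D), L y = ∑ i, u i * y i := by
    intro y
    simp [L, PiLp.inner_apply, mul_comm]
  have hlaw : HasLaw L (gaussianReal 0 σ2.toNNReal)
      (multivariateGaussian 0 (σ2 • (1 : Matrix (Fin D) (Fin D) ℝ))) := by
    refine ⟨by fun_prop, ?_⟩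
    rw [IsGaussian.map_eq_gaussianReal]
    congr 1
    · rw [ContinuousLinearMap.integral_comp_id_comm IsGaussian.integrable_id]
      simp
    · have h := covarianceBilin_self (μ := multivariateGaussian 0
        (σ2 • (1 : Matrix (Fin D) (Fin D) ℝ))) IsGaussian.memLp_two_id (WithLp.toLp 2 u)
      rw [covarianceBilin_multivariateGaussian hS] at h
      congr 1
      refine Eq.trans h.symm ?_
      rw [Matrix.smul_mulVec, dotProduct_smul, Matrix.one_mulVec, smul_eq_mul]
      simp [dotProduct, ← sq, hu]
  have := hlaw.comp hY
  simpa [Function.comp_def, hL] using this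

/-! ### The marginal likelihood of allocations with at most one feature -/

/-- The allocation in which `k` is the only feature that can be active, with history `z`. -/
def singleFeature {D N : ℕ} (k : Fin D) (z : Fin N → Bool) : Fin D → Fin N → Bool :=
  fun j n => if j = k then z n else false

/-- The likelihood of pure noise. -/
noncomputable def noiseLikelihood {D N : ℕ} (σ2 : ℝ) (Y : Fin N → EuclideanSpace ℝ (Fin D)) : ℝ :=
  (2 * Real.pi * σ2) ^ (-((D : ℝ) * (N : ℝ) / 2))
    * Real.exp (-(1 / (2 * σ2)) * ∑ n, ‖Y n‖ ^ 2)

lemma noiseLikelihood_pos {D N : ℕ} {σ2 : ℝ} (hσ2 : 0 < σ2)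
    (Y : Fin N → EuclideanSpace ℝ (Fin D)) : 0 < noiseLikelihood σ2 Y := by
  unfold noiseLikelihood
  have := Real.pi_pos
  positivity

lemma norm_sub_signal_sq {D N : ℕ} (P : Matrix.orthogonalGroup (Fin D) ℝ) (k : Fin D)
    (z : Fin N → Bool) (X : Fin D → Fin N → ℝ) (n : Fin N) (y : EuclideanSpace ℝ (Fin D)) :
    ‖y - signal (P : Matrix (Fin D) (Fin D) ℝ) (singleFeature k z) X n‖ ^ 2 =
      ‖y‖ ^ 2 - (if z n then 2 * (X k n * ∑ i, (P : Matrix (Fin D) (Fin D) ℝ) i k * y i)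
        - X k n ^ 2 else 0) := by
  have hs : ∀ i, signal (P : Matrix (Fin D) (Fin D) ℝ) (singleFeature k z) X n i =
      if z n then (P : Matrix (Fin D) (Fin D) ℝ) i k * X k n else 0 := by
    intro i
    simp only [signal, singleFeature, Matrix.mulVec, dotProduct]
    rw [Finset.sum_eq_single k]
    · split_ifs <;> simp_all
    · intro j _ hj
      simp [hj]
    · simp
  rw [EuclideanSpace.real_norm_sq_eq, EuclideanSpace.real_norm_sq_eq]
  have hP := sum_sq_col_orthogonalGroup P k
  simp only [PiLp.sub_apply, hs]
  split_ifs with hz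
  · rw [← mul_one (X k n ^ 2), ← hP, Finset.mul_sum, Finset.mul_sum, Finset.mul_sum,
      ← Finset.sum_sub_distrib, ← Finset.sum_sub_distrib]
    exact Finset.sum_congr rfl fun i _ => by ring
  · simp

lemma likelihood_singleFeature {D N : ℕ} (σ2 : ℝ) (Y : Fin N → EuclideanSpace ℝ (Fin D))
    (P : Matrix.orthogonalGroup (Fin D) ℝ) (k : Fin D) (z : Fin N → Bool)
    (X : Fin D → Fin N → ℝ) :
    likelihood σ2 Y (P : Matrix (Fin D) (Fin D) ℝ) (singleFeature k z) X =
      noiseLikelihood σ2 Y * ∏ n, if z n then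
        Real.exp (X k n * (∑ i, (P : Matrix (Fin D) (Fin D) ℝ) i k * Y n i) / σ2
          - X k n ^ 2 / (2 * σ2)) else 1 := by
  have h : (∏ n, if z n then
        Real.exp (X k n * (∑ i, (P : Matrix (Fin D) (Fin D) ℝ) i k * Y n i) / σ2
          - X k n ^ 2 / (2 * σ2)) else 1) = Real.exp (∑ n, if z n then
        X k n * (∑ i, (P : Matrix (Fin D) (Fin D) ℝ) i k * Y n i) / σ2
          - X k n ^ 2 / (2 * σ2) else 0) := by
    rw [Real.exp_sum]
    refine Finset.prod_congr rfl fun n _ => ?_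
    split_ifs <;> simp
  rw [h, likelihood, noiseLikelihood, mul_assoc (_ ^ _) (Real.exp _), ← Real.exp_add]
  congr 2
  rw [Finset.mul_sum, Finset.mul_sum, ← Finset.sum_add_distrib]
  refine Finset.sum_congr rfl fun n _ => ?_
  rw [norm_sub_signal_sq]
  split_ifs <;> ring

/-- Only row `k` of the coefficients enters the likelihood. Its entries are independent, so the
integral factors over the observations using the feature. -/
lemma lintegral_likelihood_singleFeature {D N : ℕ} {σ2 : ℝ} (hσ2 : 0 < σ2)
    (Y : Fin N → EuclideanSpace ℝ (Fin D)) (P : Matrix.orthogonalGroup (Fin D) ℝ)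
    (k : Fin D) (z : Fin N → Bool) (δ : Fin D → ℝ) :
    ∫⁻ X, ENNReal.ofReal
        (likelihood σ2 Y (P : Matrix (Fin D) (Fin D) ℝ) (singleFeature k z) X)
        ∂coeffPrior D N σ2 δ =
      ENNReal.ofReal (noiseLikelihood σ2 Y) * ∏ n ∈ Finset.univ.filter (fun n => z n = true),
        featureRatio σ2 (δ k * σ2).toNNReal
          (∑ i, (P : Matrix (Fin D) (Fin D) ℝ) i k * Y n i) := by
  let g : Fin N → ℝ → ℝ≥0∞ := fun n x => if z n then
    ENNReal.ofReal (Real.exp (x * (∑ i, (P : Matrix (Fin D) (Fin D) ℝ) i k * Y n i) / σ2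
      - x ^ 2 / (2 * σ2))) else 1
  have hg : ∀ n, Measurable (g n) := by
    intro n
    by_cases hz : z n = true
    · simp only [g, hz, if_true]
      fun_prop
    · simp only [g, hz]
      exact measurable_const
  have h1 : ∀ X : Fin D → Fin N → ℝ, ENNReal.ofReal
      (likelihood σ2 Y (P : Matrix (Fin D) (Fin D) ℝ) (singleFeature k z) X) =
      ENNReal.ofReal (noiseLikelihood σ2 Y) * ∏ n, g n (X k n) := by
    intro X
    rw [likelihood_singleFeature, ENNReal.ofReal_mul (noiseLikelihood_pos hσ2 Y).le,
      ENNReal.ofReal_prod_of_nonneg]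
    · congr 1
      refine Finset.prod_congr rfl fun n _ => ?_
      simp only [g]
      split_ifs <;> simp
    · intro n _
      split_ifs <;> positivity
  simp_rw [h1]
  have hmeas : Measurable fun x : Fin N → ℝ => ∏ n, g n (x n) :=
    Finset.measurable_prod _ fun n _ => (hg n).comp (measurable_pi_apply n)
  rw [lintegral_const_mul _ (by exact hmeas.comp (measurable_pi_apply k))]
  congr 1
  have hmp := measurePreserving_eval
    (fun j : Fin D => Measure.pi fun _ : Fin N => gaussianReal 0 (δ j * σ2).toNNReal) k
  refine (hmp.lintegral_comp hmeas).trans ?_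
  rw [lintegral_prod_eq_prod_lintegral_of_indepFun Finset.univ
    (fun n (x : Fin N → ℝ) => g n (x n))
    (iIndepFun_pi fun n => (hg n).aemeasurable) fun n => (hg n).comp (measurable_pi_apply n),
    Finset.prod_filter]
  refine Finset.prod_congr rfl fun n _ => ?_
  refine ((measurePreserving_eval (fun _ : Fin N => gaussianReal 0 (δ k * σ2).toNNReal)
    n).lintegral_comp (hg n)).trans ?_
  simp only [g]
  split_ifs
  · rfl
  · simp

/-! ### Almost sure lower bound for mixtures of elementary symmetric means -/

lemma ae_tendsto_average_one {Ω E : Type*} [MeasurableSpace Ω] [MeasurableSpace E]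
    {μ : Measure Ω} {ρ : Measure E} {y : ℕ → Ω → E} (hindep : iIndepFun y μ)
    (hlaw : ∀ n, HasLaw (y n) ρ μ) {g : E → ℝ≥0∞} (hg : Measurable g)
    (hg1 : ∫⁻ x, g x ∂ρ = 1) :
    ∀ᵐ ω ∂μ, (∀ i, g (y i ω) ≠ ∞) ∧
      Tendsto (fun N : ℕ => (∑ i ∈ Finset.range N, (g (y i ω)).toReal) / N) atTop (𝓝 1) := by
  have hint : ∀ n, ∫⁻ ω, g (y n ω) ∂μ = 1 := by
    intro n
    rw [← hg1, ← (hlaw n).map_eq, lintegral_map' hg.aemeasurable (hlaw n).aemeasurable]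
  have hae : ∀ n, AEMeasurable (fun ω => g (y n ω)) μ := fun n =>
    hg.comp_aemeasurable (hlaw n).aemeasurable
  have hfin : ∀ n, ∀ᵐ ω ∂μ, g (y n ω) < ∞ := fun n =>
    ae_lt_top' (hae n) (by simp [hint n])
  have hgr : Measurable fun x => (g x).toReal := hg.ennreal_toReal
  have hid : ∀ i, IdentDistrib (y i) (y 0) μ μ := fun i =>
    ⟨(hlaw i).aemeasurable, (hlaw 0).aemeasurable, by rw [(hlaw i).map_eq, (hlaw 0).map_eq]⟩
  have hslln := strong_law_ae_real (μ := μ) (fun n ω => (g (y n ω)).toReal)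
    (integrable_toReal_of_lintegral_ne_top (hae 0) (by simp [hint 0]))
    (fun i j hij => (hindep.indepFun hij).comp hgr hgr)
    (fun i => (hid i).comp hgr)
  have hE : ∫ ω, (g (y 0 ω)).toReal ∂μ = 1 := by
    rw [integral_toReal (hae 0) (hfin 0), hint 0, ENNReal.toReal_one]
  rw [hE] at hslln
  filter_upwards [hslln, ae_all_iff.2 hfin] with ω h1 h2
  exact ⟨fun i => (h2 i).ne, h1⟩

/-- The strong law at each fixed `θ` gives a lower limit at least one for the integrand, and Fatou
passes it to the integral. -/
lemma ae_measure_univ_le_liminf_of_measurable {Ω E Θ : Type*} [MeasurableSpace Ω]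
    [MeasurableSpace E] [MeasurableSpace Θ] {μ : Measure Ω} [SFinite μ] {ρ : Measure E}
    {ν : Measure Θ} [SFinite ν] {y : ℕ → Ω → E} (hy : ∀ n, Measurable (y n))
    (hindep : iIndepFun y μ) (hlaw : ∀ n, HasLaw (y n) ρ μ) {G : Θ → E → ℝ≥0∞}
    (hG : Measurable (Function.uncurry G)) (hG1 : ∀ θ, ∫⁻ x, G θ x ∂ρ = 1) :
    ∀ᵐ ω ∂μ, ∀ m : ℕ, ν Set.univ ≤ liminf (fun N : ℕ => ∫⁻ θ,
      (∑ S ∈ (Finset.univ : Finset (Fin N)).powersetCard m, ∏ i ∈ S, G θ (y i ω))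
        / (N.choose m : ℝ≥0∞) ∂ν) atTop := by
  have hGy : ∀ n, Measurable fun q : Ω × Θ => G q.2 (y n q.1) := fun n =>
    hG.comp (measurable_snd.prodMk ((hy n).comp measurable_fst))
  have hmeas : MeasurableSet {q : Ω × Θ | (∀ i, G q.2 (y i q.1) ≠ ∞) ∧
      Tendsto (fun N : ℕ => (∑ i ∈ Finset.range N, (G q.2 (y i q.1)).toReal) / N)
        atTop (𝓝 1)} := by
    refine MeasurableSet.inter (s₁ := {q : Ω × Θ | ∀ i, G q.2 (y i q.1) ≠ ∞}) ?_ ?_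
    · rw [Set.ofPred_forall]
      exact MeasurableSet.iInter fun i =>
        (measurableSet_eq_fun (hGy i) measurable_const).compl
    · refine measurableSet_tendsto _ fun N => Measurable.div_const ?_ _
      exact Finset.measurable_sum _ fun i _ => (hGy i).ennreal_toReal
  -- The exceptional null set of the strong law depends on `θ`; Fubini gives, for almost every `ω`,
  -- the convergence for `ν`-almost every `θ`.
  have hae := (Measure.ae_ae_comm (μ := μ) (ν := ν)
    (p := fun ω θ => (∀ i, G θ (y i ω) ≠ ∞) ∧
      Tendsto (fun N : ℕ => (∑ i ∈ Finset.range N, (G θ (y i ω)).toReal) / N)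
        atTop (𝓝 1)) hmeas).2 (ae_of_all _ fun θ => ae_tendsto_average_one hindep hlaw
          (hG.comp measurable_prodMk_left) (hG1 θ))
  filter_upwards [hae] with ω hω m
  refine le_trans ?_ (lintegral_liminf_le fun N => ?_)
  · rw [← lintegral_one]
    refine lintegral_mono_ae ?_
    filter_upwards [hω] with θ hθ
    exact one_le_liminf_esymm hθ.1 hθ.2 m
  · refine Measurable.div_const (Finset.measurable_sum _ fun S _ =>
      Finset.measurable_prod _ fun i _ => ?_) _
    exact hG.comp measurable_prodMk_right

lemma ae_measure_univ_le_liminf {Ω E Θ : Type*} [MeasurableSpace Ω]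
    [MeasurableSpace E] [MeasurableSpace Θ] {μ : Measure Ω} [SFinite μ] {ρ : Measure E}
    {ν : Measure Θ} [SFinite ν] {y : ℕ → Ω → E}
    (hindep : iIndepFun y μ) (hlaw : ∀ n, HasLaw (y n) ρ μ) {G : Θ → E → ℝ≥0∞}
    (hG : Measurable (Function.uncurry G)) (hG1 : ∀ θ, ∫⁻ x, G θ x ∂ρ = 1) :
    ∀ᵐ ω ∂μ, ∀ m : ℕ, ν Set.univ ≤ liminf (fun N : ℕ => ∫⁻ θ,
      (∑ S ∈ (Finset.univ : Finset (Fin N)).powersetCard m, ∏ i ∈ S, G θ (y i ω))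
        / (N.choose m : ℝ≥0∞) ∂ν) atTop := by
  have hmk : ∀ n, y n =ᵐ[μ] (hlaw n).aemeasurable.mk (y n) := fun n =>
    (hlaw n).aemeasurable.ae_eq_mk
  have h := ae_measure_univ_le_liminf_of_measurable (ν := ν)
    (fun n => (hlaw n).aemeasurable.measurable_mk) ((iIndepFun_congr hmk).1 hindep)
    (fun n => (hlaw n).congr (hmk n).symm) hG hG1
  filter_upwards [h, ae_all_iff.2 hmk] with ω h1 h2
  simpa only [h2] using h1

/-! ### The priors -/

instance isProbabilityMeasure_uniformOrthogonal (D : ℕ) :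
    IsProbabilityMeasure (uniformOrthogonal D) :=
  ⟨Measure.haarMeasure_self⟩

lemma measurable_sIGDensity (a b : ℝ) : Measurable (sIGDensity a b) := by
  unfold sIGDensity
  exact Measurable.ite measurableSet_Ioi (by fun_prop) measurable_const

/-- Finiteness suffices: the total mass of the prior is a common factor of the two weights compared,
so its value is never needed. -/
lemma isFiniteMeasure_sIG {a b : ℝ} (ha : 0 < a) (hb : 0 < b) : IsFiniteMeasure (sIG a b) := by
  refine ⟨?_⟩
  rw [sIG, withDensity_apply _ MeasurableSet.univ, Measure.restrict_univ]
  have hbd : IntegrableOn (fun x : ℝ => b ^ a / lowerGamma a b * (x + 1) ^ (-(a + 1)))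
      (Set.Ioi 0) :=
    (integrableOn_add_rpow_Ioi_of_lt (by linarith) (by norm_num)).const_mul _
  have hγ : 0 ≤ b ^ a / lowerGamma a b := by
    refine div_nonneg (Real.rpow_nonneg hb.le _) ?_
    refine intervalIntegral.integral_nonneg hb.le fun t ht => ?_
    exact mul_nonneg (Real.rpow_nonneg ht.1 _) (Real.exp_pos _).le
  calc ∫⁻ x, ENNReal.ofReal (sIGDensity a b x)
      ≤ ∫⁻ x, (Set.Ioi 0).indicator (fun x =>
          ENNReal.ofReal (b ^ a / lowerGamma a b * (x + 1) ^ (-(a + 1)))) x := by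
        refine lintegral_mono fun x => ?_
        by_cases hx : 0 < x
        · rw [Set.indicator_of_mem (Set.mem_Ioi.2 hx)]
          refine ENNReal.ofReal_le_ofReal ?_
          have h1 : (1 / (1 + x)) ^ (a + 1) = (x + 1) ^ (-(a + 1)) := by
            rw [one_div, Real.inv_rpow (by linarith), Real.rpow_neg (by linarith), add_comm x]
          simp only [sIGDensity, hx, if_true, h1]
          refine mul_le_of_le_one_right
            (mul_nonneg hγ (Real.rpow_nonneg (by linarith) _)) ?_
          rw [Real.exp_le_one_iff, neg_div]
          exact neg_nonpos.2 (div_nonneg hb.le (by linarith))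
        · simp [sIGDensity, hx]
    _ = ∫⁻ x in Set.Ioi 0,
          ENNReal.ofReal (b ^ a / lowerGamma a b * (x + 1) ^ (-(a + 1))) :=
        lintegral_indicator measurableSet_Ioi _
    _ < ∞ := hbd.lintegral_lt_top

/-! ### Indian buffet process weights of allocations with at most one feature -/

lemma isActive_singleFeature {D N : ℕ} (k j : Fin D) (z : Fin N → Bool) :
    IsActive (singleFeature k z) j ↔ j = k ∧ ∃ n, z n = true := by
  by_cases h : j = k <;> simp [IsActive, singleFeature, h]

open Classical in
lemma filter_isActive_singleFeature {D N : ℕ} (k : Fin D) {z : Fin N → Bool}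
    (hz : ∃ n, z n = true) :
    Finset.univ.filter (fun j => IsActive (singleFeature k z) j) = {k} := by
  ext j
  simp [isActive_singleFeature, hz]

lemma numActive_singleFeature {D N : ℕ} (k : Fin D) {z : Fin N → Bool} (hz : ∃ n, z n = true) :
    numActive (singleFeature k z) = 1 := by
  rw [numActive, filter_isActive_singleFeature k hz, Finset.card_singleton]

/-- The only possibly nonzero row has the least index, so the rows are in decreasing order. -/
lemma singleFeature_mem_leftOrdered {D N : ℕ} {k : Fin D} (hk : ∀ j, k ≤ j) (z : Fin N → Bool) :
    singleFeature k z ∈ leftOrdered D N := by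
  classical
  rw [leftOrdered, Finset.mem_filter]
  refine ⟨Finset.mem_univ _, fun i j hij => ?_⟩
  refine Pi.toLex_monotone fun n => ?_
  by_cases hj : j = k
  · have hi : i = k := le_antisymm (hij.trans hj.le) (hk i)
    rw [hi, hj]
  · simp [singleFeature, hj]

lemma singleFeature_injective {D N : ℕ} (k : Fin D) :
    Function.Injective (singleFeature k : (Fin N → Bool) → Fin D → Fin N → Bool) := by
  intro z w h
  ext n
  have := congrFun (congrFun h k) n
  simp_all [singleFeature]

open Classical in
lemma ibpProb_singleFeature {D N : ℕ} (α : ℝ) (k : Fin D) {z : Fin N → Bool}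
    (hz : ∃ n, z n = true) :
    ibpProb α (singleFeature k z) =
      α * Real.exp (-α * ∑ n ∈ Finset.Icc 1 N, (1 / n : ℝ)) *
        (((N - (Finset.univ.filter fun n => z n = true).card).factorial : ℝ) *
          (((Finset.univ.filter fun n => z n = true).card - 1).factorial : ℝ) /
            (N.factorial : ℝ)) := by
  have hprod : ∏ h ∈ Finset.univ.filter (fun h : Fin N → Bool => ∃ n, h n = true),
      ((historyCount (singleFeature k z) h).factorial : ℝ) = 1 := by
    refine Finset.prod_eq_one fun h hh => ?_
    obtain ⟨n, hn⟩ := (Finset.mem_filter.1 hh).2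
    have hle : historyCount (singleFeature k z) h ≤ 1 := by
      rw [historyCount, ← Finset.card_singleton k]
      refine Finset.card_le_card fun j hj => ?_
      rw [Finset.mem_singleton]
      by_contra hjk
      have h1 := congrFun (Finset.mem_filter.1 hj).2 n
      simp [singleFeature, hjk, hn] at h1
    rw [Nat.factorial_eq_one.2 hle, Nat.cast_one]
  rw [ibpProb, numActive_singleFeature k hz, filter_isActive_singleFeature k hz,
    Finset.prod_singleton, pow_one]
  have hrow : rowCount (singleFeature k z) k = (Finset.univ.filter fun n => z n = true).card := by
    rw [rowCount]
    congr 1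
    ext n
    simp [singleFeature]
  rw [hrow]
  congr 1
  convert div_one _ using 2

lemma singleFeature_false {D N : ℕ} (k : Fin D) :
    singleFeature k (fun _ : Fin N => false) = fun _ _ => false := by
  ext j n
  simp [singleFeature]

open Classical in
lemma numActive_eq_zero_iff {D N : ℕ} (Z : Fin D → Fin N → Bool) :
    numActive Z = 0 ↔ Z = fun _ _ => false := by
  rw [numActive, Finset.card_eq_zero, Finset.filter_eq_empty_iff]
  constructor
  · intro h
    ext k n
    simpa [IsActive] using fun hn => h (Finset.mem_univ k) ⟨n, hn⟩
  · rintro rfl k -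
    simp [IsActive]

open Classical in
lemma ibpProb_false {D N : ℕ} (α : ℝ) :
    ibpProb α (fun (_ : Fin D) (_ : Fin N) => false) =
      Real.exp (-α * ∑ n ∈ Finset.Icc 1 N, (1 / n : ℝ)) := by
  have h0 := (numActive_eq_zero_iff (fun (_ : Fin D) (_ : Fin N) => false)).2 rfl
  rw [ibpProb, h0]
  have hprod : ∏ h ∈ Finset.univ.filter (fun h : Fin N → Bool => ∃ n, h n = true),
      ((historyCount (fun (_ : Fin D) (_ : Fin N) => false) h).factorial : ℝ) = 1 := by
    refine Finset.prod_eq_one fun h hh => ?_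
    obtain ⟨n, hn⟩ := (Finset.mem_filter.1 hh).2
    have hle : historyCount (fun (_ : Fin D) (_ : Fin N) => false) h = 0 := by
      rw [historyCount, Finset.card_eq_zero, Finset.filter_eq_empty_iff]
      intro j _ hj
      have h1 := congrFun hj n
      simp [hn] at h1
    rw [hle, Nat.factorial_zero, Nat.cast_one]
  have hact : ∀ k : Fin D, ¬ IsActive (fun (_ : Fin D) (_ : Fin N) => false) k := by
    simp [IsActive]
  simp only [hact, Finset.filter_false, Finset.prod_empty, pow_zero, one_mul, mul_one]
  convert div_one _ using 2

/-! ### Comparison of the joint weights -/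

/-- The joint prior of the scale parameters and of the orthonormal basis. -/
noncomputable def basisPrior (D : ℕ) (a b : ℝ) :
    Measure ((Fin D → ℝ) × Matrix.orthogonalGroup (Fin D) ℝ) :=
  (Measure.pi fun _ : Fin D => sIG a b).prod (uniformOrthogonal D)

/-- The likelihood ratio of the observation `y` when feature `k` is used, given the scale
parameters and the orthonormal basis. -/
noncomputable def basisRatio {D : ℕ} (σ2 : ℝ) (k : Fin D)
    (θ : (Fin D → ℝ) × Matrix.orthogonalGroup (Fin D) ℝ) (y : EuclideanSpace ℝ (Fin D)) : ℝ≥0∞ :=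
  featureRatio σ2 (θ.1 k * σ2).toNNReal (∑ i, (θ.2 : Matrix (Fin D) (Fin D) ℝ) i k * y i)

lemma measurable_basisRatio {D : ℕ} (σ2 : ℝ) (k : Fin D) :
    Measurable (Function.uncurry (basisRatio σ2 k)) := by
  have hentry : ∀ i, Measurable fun P : Matrix.orthogonalGroup (Fin D) ℝ =>
      (P : Matrix (Fin D) (Fin D) ℝ) i k := fun i =>
    (continuous_subtype_val.matrix_elem i k).measurable
  refine (measurable_featureRatio σ2).comp (Measurable.prodMk ?_ ?_)
  · exact (measurable_pi_apply k).comp (measurable_fst.comp measurable_fst)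
  · refine Finset.measurable_sum Finset.univ (f := fun i (q : ((Fin D → ℝ) ×
      Matrix.orthogonalGroup (Fin D) ℝ) × EuclideanSpace ℝ (Fin D)) =>
        (q.1.2 : Matrix (Fin D) (Fin D) ℝ) i k * q.2 i) fun i _ => Measurable.mul ?_ ?_
    · exact (hentry i).comp (measurable_snd.comp measurable_fst)
    · exact (by fun_prop : Measurable fun y : EuclideanSpace ℝ (Fin D) => y i).comp measurable_snd

lemma lintegral_basisRatio {D : ℕ} {σ2 : ℝ} (hσ2 : 0 < σ2) (k : Fin D)
    (θ : (Fin D → ℝ) × Matrix.orthogonalGroup (Fin D) ℝ) :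
    ∫⁻ y, basisRatio σ2 k θ y
      ∂multivariateGaussian 0 (σ2 • (1 : Matrix (Fin D) (Fin D) ℝ)) = 1 := by
  have hlaw := hasLaw_dotProduct hσ2 HasLaw.id (sum_sq_col_orthogonalGroup θ.2 k)
  have hm : Measurable (featureRatio σ2 (θ.1 k * σ2).toNNReal) :=
    (measurable_featureRatio σ2).comp measurable_prodMk_left
  rw [← lintegral_featureRatio hσ2 (θ.1 k * σ2).toNNReal, ← hlaw.map_eq,
    lintegral_map' hm.aemeasurable hlaw.aemeasurable]
  rfl

lemma marginalLikelihood_singleFeature {D N : ℕ} {a b σ2 : ℝ} (ha : 0 < a) (hb : 0 < b)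
    (hσ2 : 0 < σ2) (Y : Fin N → EuclideanSpace ℝ (Fin D)) (k : Fin D) (z : Fin N → Bool) :
    marginalLikelihood a b σ2 Y (singleFeature k z) =
      ENNReal.ofReal (noiseLikelihood σ2 Y) *
        ∫⁻ θ, ∏ n ∈ Finset.univ.filter (fun n => z n = true), basisRatio σ2 k θ (Y n)
          ∂basisPrior D a b := by
  have := isFiniteMeasure_sIG ha hb
  have hm : Measurable fun θ => ∏ n ∈ Finset.univ.filter (fun n => z n = true),
      basisRatio σ2 k θ (Y n) :=
    Finset.measurable_prod _ fun n _ => (measurable_basisRatio σ2 k).comp measurable_prodMk_right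
  rw [← lintegral_const_mul _ hm, basisPrior, lintegral_prod _ (hm.const_mul _).aemeasurable]
  simp only [marginalLikelihood, lintegral_likelihood_singleFeature hσ2, basisRatio]

/-- The empty allocation is a single feature with empty history; the empty product integrates to the
prior mass. -/
lemma jointWeight_zero {D N : ℕ} {a b α σ2 : ℝ} (ha : 0 < a) (hb : 0 < b) (hσ2 : 0 < σ2)
    (Y : Fin N → EuclideanSpace ℝ (Fin D)) (k : Fin D) (hk : ∀ j, k ≤ j) :
    jointWeight a b α σ2 Y 0 =
      ENNReal.ofReal (Real.exp (-α * ∑ n ∈ Finset.Icc 1 N, (1 / n : ℝ))) *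
        (ENNReal.ofReal (noiseLikelihood σ2 Y) * basisPrior D a b Set.univ) := by
  have hfilter : (leftOrdered D N).filter (fun Z => numActive Z = 0) =
      {fun _ _ => false} := by
    ext Z
    rw [Finset.mem_filter, numActive_eq_zero_iff, Finset.mem_singleton]
    refine ⟨fun h => h.2, fun h => ⟨?_, h⟩⟩
    rw [h, ← singleFeature_false k]
    exact singleFeature_mem_leftOrdered hk _
  rw [jointWeight, hfilter, Finset.sum_singleton, ibpProb_false, ← singleFeature_false k,
    marginalLikelihood_singleFeature ha hb hσ2]
  simp

/-- The mean, over the sets `S` of `m` observations, of the likelihood ratio of the allocation in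
which feature `k` is used exactly by the observations in `S`. -/
noncomputable def meanRatio {D N : ℕ} (a b σ2 : ℝ) (k : Fin D)
    (Y : Fin N → EuclideanSpace ℝ (Fin D)) (m : ℕ) : ℝ≥0∞ :=
  ∫⁻ θ, (∑ S ∈ (Finset.univ : Finset (Fin N)).powersetCard m, ∏ i ∈ S, basisRatio σ2 k θ (Y i))
    / (N.choose m : ℝ≥0∞) ∂basisPrior D a b

/-- The identity `(N - m)! (m - 1)! / N! = 1 / (m * N.choose m)` makes the prior uniform over
`m`-subsets, with relative total `α / m`. -/
lemma sum_powersetCard_weight {D N : ℕ} {a b α σ2 : ℝ} (ha : 0 < a) (hb : 0 < b) (hα : 0 < α)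
    (hσ2 : 0 < σ2) (Y : Fin N → EuclideanSpace ℝ (Fin D)) (k : Fin D) {m : ℕ} (hm : 1 ≤ m)
    (hmN : m ≤ N) :
    ∑ S ∈ (Finset.univ : Finset (Fin N)).powersetCard m,
      ENNReal.ofReal (ibpProb α (singleFeature k fun n => decide (n ∈ S))) *
        marginalLikelihood a b σ2 Y (singleFeature k fun n => decide (n ∈ S)) =
      ENNReal.ofReal (α / m) *
        (ENNReal.ofReal (Real.exp (-α * ∑ n ∈ Finset.Icc 1 N, (1 / n : ℝ))) *
          (ENNReal.ofReal (noiseLikelihood σ2 Y) * meanRatio a b σ2 k Y m)) := by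
  set e := Real.exp (-α * ∑ n ∈ Finset.Icc 1 N, (1 / n : ℝ)) with he
  have hmp : (0 : ℝ) < m := by exact_mod_cast hm
  have hc : (0 : ℝ) < N.choose m := by exact_mod_cast Nat.choose_pos hmN
  have hcoef : ((N - m).factorial : ℝ) * ((m - 1).factorial : ℝ) / (N.factorial : ℝ) =
      1 / m * (N.choose m : ℝ)⁻¹ := by
    rw [← Nat.choose_mul_factorial_mul_factorial hmN, ← Nat.mul_factorial_pred (by omega : m ≠ 0)]
    push_cast
    have h1 : ((N - m).factorial : ℝ) ≠ 0 := by positivity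
    have h2 : ((m - 1).factorial : ℝ) ≠ 0 := by positivity
    field_simp
  have hmeas : ∀ S : Finset (Fin N), Measurable fun θ => ∏ i ∈ S, basisRatio σ2 k θ (Y i) :=
    fun S => Finset.measurable_prod _ fun n _ =>
      (measurable_basisRatio σ2 k).comp measurable_prodMk_right
  have hterm : ∀ S ∈ (Finset.univ : Finset (Fin N)).powersetCard m,
      ENNReal.ofReal (ibpProb α (singleFeature k fun n => decide (n ∈ S))) *
        marginalLikelihood a b σ2 Y (singleFeature k fun n => decide (n ∈ S)) =
      ENNReal.ofReal (α / m) * (ENNReal.ofReal e * (ENNReal.ofReal (noiseLikelihood σ2 Y) *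
        ((N.choose m : ℝ≥0∞)⁻¹ * ∫⁻ θ, ∏ i ∈ S, basisRatio σ2 k θ (Y i) ∂basisPrior D a b))) := by
    intro S hS
    have hcard := (Finset.mem_powersetCard.1 hS).2
    obtain ⟨n₀, hn₀⟩ : S.Nonempty := Finset.card_pos.1 (by omega)
    have hfil : Finset.univ.filter (fun n => decide (n ∈ S) = true) = S := by
      ext n
      simp
    rw [ibpProb_singleFeature α k ⟨n₀, by simpa using hn₀⟩,
      marginalLikelihood_singleFeature ha hb hσ2, hfil, hcard, hcoef, ← he]
    have h3 : α * e * (1 / (m : ℝ) * (N.choose m : ℝ)⁻¹) =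
        α / m * (e * (N.choose m : ℝ)⁻¹) := by ring
    have he0 : 0 < e := Real.exp_pos _
    rw [h3, ENNReal.ofReal_mul (by positivity), ENNReal.ofReal_mul he0.le,
      ENNReal.ofReal_inv_of_pos hc, ENNReal.ofReal_natCast]
    ring
  rw [Finset.sum_congr rfl hterm, ← Finset.mul_sum, ← Finset.mul_sum, ← Finset.mul_sum,
    ← Finset.mul_sum, meanRatio]
  congr 3
  simp_rw [div_eq_mul_inv]
  rw [lintegral_mul_const _ (Finset.measurable_sum _ fun S _ => hmeas S),
    lintegral_finsetSum _ fun S _ => hmeas S, mul_comm]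

/-- Distinct supports give distinct left-ordered matrices with one active feature; all others with
`K = 1` are dropped. -/
lemma sum_le_jointWeight_one {D N : ℕ} {a b α σ2 : ℝ} (ha : 0 < a) (hb : 0 < b) (hα : 0 < α)
    (hσ2 : 0 < σ2) (Y : Fin N → EuclideanSpace ℝ (Fin D)) (k : Fin D) (hk : ∀ j, k ≤ j)
    {M : ℕ} (hM : M ≤ N) :
    ∑ m ∈ Finset.Icc 1 M, ENNReal.ofReal (α / m) *
        (ENNReal.ofReal (Real.exp (-α * ∑ n ∈ Finset.Icc 1 N, (1 / n : ℝ))) *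
          (ENNReal.ofReal (noiseLikelihood σ2 Y) * meanRatio a b σ2 k Y m)) ≤
      jointWeight a b α σ2 Y 1 := by
  classical
  let φ : Finset (Fin N) → Fin D → Fin N → Bool := fun S => singleFeature k fun n => decide (n ∈ S)
  have hφ : Function.Injective φ := by
    intro S T h
    ext n
    simpa using congrFun (singleFeature_injective k h) n
  have hdisj : Set.PairwiseDisjoint (Finset.Icc 1 M : Set ℕ)
      fun m => (Finset.univ : Finset (Fin N)).powersetCard m :=
    fun i _ j _ hij => Finset.pairwise_disjoint_powersetCard _ hij
  have hsum : ∀ m ∈ Finset.Icc 1 M, ENNReal.ofReal (α / m) *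
        (ENNReal.ofReal (Real.exp (-α * ∑ n ∈ Finset.Icc 1 N, (1 / n : ℝ))) *
          (ENNReal.ofReal (noiseLikelihood σ2 Y) * meanRatio a b σ2 k Y m)) =
      ∑ S ∈ (Finset.univ : Finset (Fin N)).powersetCard m,
        ENNReal.ofReal (ibpProb α (φ S)) * marginalLikelihood a b σ2 Y (φ S) := fun m hm =>
    (sum_powersetCard_weight ha hb hα hσ2 Y k (Finset.mem_Icc.1 hm).1
      ((Finset.mem_Icc.1 hm).2.trans hM)).symm
  rw [Finset.sum_congr rfl hsum, ← Finset.sum_biUnion hdisj,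
    ← Finset.sum_image (f := fun Z => ENNReal.ofReal (ibpProb α Z) * marginalLikelihood a b σ2 Y Z)
      hφ.injOn, jointWeight]
  refine Finset.sum_le_sum_of_subset fun Z hZ => ?_
  obtain ⟨S, hS, rfl⟩ := Finset.mem_image.1 hZ
  obtain ⟨m, hm, hSm⟩ := Finset.mem_biUnion.1 hS
  have hcard := (Finset.mem_powersetCard.1 hSm).2
  obtain ⟨n₀, hn₀⟩ : S.Nonempty := Finset.card_pos.1 (by
    have := (Finset.mem_Icc.1 hm).1
    omega)
  exact Finset.mem_filter.2 ⟨singleFeature_mem_leftOrdered hk _,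
    numActive_singleFeature k ⟨n₀, by simpa using hn₀⟩⟩

lemma posteriorDim_zero_le {D N : ℕ} {a b α σ2 : ℝ} (hD : 1 ≤ D) (ha : 0 < a) (hb : 0 < b)
    (hα : 0 < α) (hσ2 : 0 < σ2) (Y : Fin N → EuclideanSpace ℝ (Fin D)) (k : Fin D)
    (hk : ∀ j, k ≤ j) {M : ℕ} (hM0 : 1 ≤ M) (hM : M ≤ N)
    (h : ∀ m ∈ Finset.Icc 1 M, basisPrior D a b Set.univ / 2 ≤ meanRatio a b σ2 k Y m) :
    posteriorDim a b α σ2 Y 0 ≤ (ENNReal.ofReal (α / 2 * ∑ m ∈ Finset.Icc 1 M, (1 / m : ℝ)))⁻¹ := by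
  set c := ENNReal.ofReal (α / 2 * ∑ m ∈ Finset.Icc 1 M, (1 / m : ℝ)) with hc
  have hc0 : c ≠ 0 := by
    rw [hc, Ne, ENNReal.ofReal_eq_zero, not_le]
    refine mul_pos (half_pos hα) (Finset.sum_pos (fun m hm => ?_) ⟨1, by simp [hM0]⟩)
    have := (Finset.mem_Icc.1 hm).1
    positivity
  have hsum : c = ∑ m ∈ Finset.Icc 1 M, ENNReal.ofReal (α / m) / 2 := by
    rw [hc, Finset.mul_sum, ENNReal.ofReal_sum_of_nonneg fun m _ => by positivity]
    refine Finset.sum_congr rfl fun m _ => ?_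
    rw [show (2 : ℝ≥0∞) = ENNReal.ofReal 2 by simp, ← ENNReal.ofReal_div_of_pos two_pos]
    congr 1
    ring
  have hle : c * jointWeight a b α σ2 Y 0 ≤ jointWeight a b α σ2 Y 1 := by
    refine le_trans ?_ (sum_le_jointWeight_one ha hb hα hσ2 Y k hk hM)
    rw [jointWeight_zero ha hb hσ2 Y k hk, hsum, Finset.sum_mul]
    refine Finset.sum_le_sum fun m hm => ?_
    calc _ = ENNReal.ofReal (α / m) *
          (ENNReal.ofReal (Real.exp (-α * ∑ n ∈ Finset.Icc 1 N, (1 / n : ℝ))) *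
            (ENNReal.ofReal (noiseLikelihood σ2 Y) * (basisPrior D a b Set.univ / 2))) := by
          simp only [div_eq_mul_inv]
          ring
      _ ≤ _ := by gcongr; exact h m hm
  rw [posteriorDim]
  -- This needs no condition on the denominator, so zero or infinite total weight is not a separate
  -- case.
  refine ENNReal.div_le_of_le_mul ?_
  calc jointWeight a b α σ2 Y 0 = c⁻¹ * (c * jointWeight a b α σ2 Y 0) := by
        rw [← mul_assoc, ENNReal.inv_mul_cancel hc0 ENNReal.ofReal_ne_top, one_mul]
    _ ≤ c⁻¹ * ∑ j ∈ Finset.range (D + 1), jointWeight a b α σ2 Y j := by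
        gcongr
        exact hle.trans (Finset.single_le_sum (f := fun j => jointWeight a b α σ2 Y j)
          (fun _ _ => zero_le) (Finset.mem_range.2 (by omega)))

end BNPPCA

/-! ### Conclusion from the divergence of the harmonic series -/

theorem theorem2 {Ω : Type*} [MeasurableSpace Ω] (μ : Measure Ω) [IsProbabilityMeasure μ]
    (D : ℕ) (hD : 1 ≤ D)
    (a b : ℝ) (ha : 0 < a) (hb : 0 < b)
    (α : ℝ) (hα : 0 < α)
    (σ2 : ℝ) (hσ2 : 0 < σ2)
    (y : ℕ → Ω → EuclideanSpace ℝ (Fin D))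
    (hindep : iIndepFun y μ)
    (hlaw : ∀ n, HasLaw (y n)
      (multivariateGaussian 0 (σ2 • (1 : Matrix (Fin D) (Fin D) ℝ))) μ) :
    ∀ᵐ ω ∂μ, Tendsto
      (fun N : ℕ => BNPPCA.posteriorDim a b α σ2 (fun n : Fin N => y n ω) 0)
      atTop (𝓝 0) := by
  have := BNPPCA.isFiniteMeasure_sIG ha hb
  have hfin : IsFiniteMeasure (BNPPCA.basisPrior D a b) := by
    unfold BNPPCA.basisPrior
    infer_instance
  let k : Fin D := ⟨0, hD⟩
  have hk : ∀ j : Fin D, k ≤ j := fun j => Nat.zero_le _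
  filter_upwards [BNPPCA.ae_measure_univ_le_liminf (ν := BNPPCA.basisPrior D a b) hindep hlaw
    (BNPPCA.measurable_basisRatio σ2 k) (BNPPCA.lintegral_basisRatio hσ2 k)] with ω hω
  have hev : ∀ m : ℕ, ∀ᶠ N : ℕ in atTop, BNPPCA.basisPrior D a b Set.univ / 2 ≤
      BNPPCA.meanRatio a b σ2 k (fun n : Fin N => y n ω) m := by
    intro m
    -- Halving the mass leaves strict room below the lower limit only if the mass is nonzero;
    -- otherwise the bound is trivial.
    rcases eq_or_ne (BNPPCA.basisPrior D a b Set.univ) 0 with h0 | h0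
    · simp [h0]
    · have hlt := (ENNReal.half_lt_self h0 (measure_ne_top _ _)).trans_le (hω m)
      exact (eventually_lt_of_lt_liminf hlt).mono fun N hN => hN.le
  have hdiv : Tendsto (fun M : ℕ => (ENNReal.ofReal
      (α / 2 * ∑ m ∈ Finset.Icc 1 M, (1 / m : ℝ)))⁻¹) atTop (𝓝 0) := by
    rw [← ENNReal.inv_top]
    refine (continuous_inv.tendsto (∞ : ℝ≥0∞)).comp ?_
    refine ENNReal.tendsto_ofReal_atTop.comp (Tendsto.const_mul_atTop (half_pos hα) ?_)
    refine Real.tendsto_sum_range_one_div_nat_succ_atTop.congr fun M => ?_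
    induction M with
    | zero => simp
    | succ M ih =>
      rw [Finset.sum_range_succ, ih, Finset.sum_Icc_succ_top (by omega)]
      push_cast
      rfl
  rw [ENNReal.tendsto_nhds_zero]
  intro ε hε
  -- `M` is fixed from `ε` before `N` grows, so only finitely many sizes `m` need to satisfy their
  -- eventual bound simultaneously.
  obtain ⟨M, hMε, hM0⟩ := ((hdiv.eventually_le_const hε).and (eventually_ge_atTop 1)).exists
  have hall : ∀ᶠ N : ℕ in atTop, ∀ m ∈ Finset.Icc 1 M, BNPPCA.basisPrior D a b Set.univ / 2 ≤
      BNPPCA.meanRatio a b σ2 k (fun n : Fin N => y n ω) m :=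
    (Finset.eventually_all _).2 fun m _ => hev m
  filter_upwards [hall, eventually_ge_atTop M] with N hN hMN
  exact (BNPPCA.posteriorDim_zero_le hD ha hb hα hσ2 _ k hk hM0 hMN hN).trans hMε
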